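/- Let $\gamma$ be an ordinal, and give $[0,\gamma]$ the order topology. For a topological space $X$, let $C_s(X)$ be the set of continuous functions $X\to\mathbb{R}$ with the topology of uniform convergence on countable subsets of $X$, i.e. the topology with base the sets $\{g\in C(X):\sup_{x\in A}|f(x)-g(x)|<\varepsilon\}$, where $f\in C(X)$, $A\subseteq X$ is countable and $\varepsilon>0$. For a topological space $Y$, the cellularity $c(Y)$ is the least infinite cardinal $\kappa$ such that every family of pairwise disjoint non-empty open subsets of $Y$ has cardinality at most $\kappa$. Let $X$ be a countably compact subspace of $[0,\gamma]$. Then: 1. $c(C_s(X))=\omega$ if and only if $X$ is compact and countable; 2. $c(C_s(X))=\omega_1$ if and only if $X$ is uncountable. In particular, if $\mathrm{cf}(\gamma)>\omega$, then $c(C_s([0,\gamma)))=\omega_1$. -/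

import Mathlib

universe u

/-- A cellular family in a space `Y`: a family of pairwise disjoint nonempty open subsets. -/
def IsCellularFamily {Y : Type u} [TopologicalSpace Y] (F : Set (Set Y)) : Prop :=
  (∀ U ∈ F, IsOpen U ∧ U.Nonempty) ∧ F.PairwiseDisjoint id

/-- The cellularity `c(Y)`: the least infinite cardinal `κ` such that every cellular family in `Y`
has at most `κ` members. -/
noncomputable def cellularity (Y : Type u) [TopologicalSpace Y] : Cardinal.{u} :=
  sInf {κ : Cardinal.{u} |
    Cardinal.aleph0 ≤ κ ∧ ∀ F : Set (Set Y), IsCellularFamily F → Cardinal.mk F ≤ κ}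

/-- `C_s(X)`: the set of continuous real-valued functions on `X`, a copy of `C(X, ℝ)` which carries
the topology of uniform convergence on countable subsets of `X` (see the instance below). -/
def Cs (X : Type u) [TopologicalSpace X] : Type u := C(X, ℝ)

namespace Cs

variable {X : Type u} [TopologicalSpace X]

instance : FunLike (Cs X) X ℝ := inferInstanceAs (FunLike C(X, ℝ) X ℝ)

/-- `V°(f, A, ε) = {g ∈ C(X) : sup_{x ∈ A} |f x - g x| < ε}`; the supremum is taken
in `[0, ∞]`. -/
def basicSet (f : Cs X) (A : Set X) (ε : ℝ) : Set (Cs X) :=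
  {g | (⨆ x ∈ A, edist (f x) (g x)) < ENNReal.ofReal ε}

theorem basicSet_inter_subset (f : Cs X) (A B : Set X) (ε δ : ℝ) :
    basicSet f (A ∪ B) (min ε δ) ⊆ basicSet f A ε ∩ basicSet f B δ := by
  intro g hg
  simp only [basicSet, Set.mem_ofPred_eq, iSup_union, sup_lt_iff] at hg
  exact ⟨hg.1.trans_le (ENNReal.ofReal_le_ofReal (min_le_left _ _)),
    hg.2.trans_le (ENNReal.ofReal_le_ofReal (min_le_right _ _))⟩

/-- The open sets of `C_s(X)` are those that contain, with each `f`, some `V°(f, A, ε)` with `A`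
countable and `ε > 0`; equivalently, the unions of such sets (`Cs.isOpen_iff_sUnion`). -/
instance : TopologicalSpace (Cs X) where
  IsOpen U := ∀ f ∈ U, ∃ A : Set X, A.Countable ∧ ∃ ε : ℝ, 0 < ε ∧ basicSet f A ε ⊆ U
  isOpen_univ _ _ := ⟨∅, Set.countable_empty, 1, one_pos, Set.subset_univ _⟩
  isOpen_inter U V hU hV f hf := by
    obtain ⟨A, hA, ε, hε, hAU⟩ := hU f hf.1
    obtain ⟨B, hB, δ, hδ, hBV⟩ := hV f hf.2
    exact ⟨A ∪ B, hA.union hB, min ε δ, lt_min hε hδ,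
      (basicSet_inter_subset f A B ε δ).trans (Set.inter_subset_inter hAU hBV)⟩
  isOpen_sUnion S hS f hf := by
    obtain ⟨U, hU, hfU⟩ := hf
    obtain ⟨A, hA, ε, hε, h⟩ := hS U hU f hfU
    exact ⟨A, hA, ε, hε, h.trans (Set.subset_sUnion_of_mem hU)⟩

theorem isOpen_iff {U : Set (Cs X)} :
    IsOpen U ↔ ∀ f ∈ U, ∃ A : Set X, A.Countable ∧ ∃ ε : ℝ, 0 < ε ∧ basicSet f A ε ⊆ U :=
  Iff.rfl

theorem mem_basicSet_self (f : Cs X) (A : Set X) {ε : ℝ} (hε : 0 < ε) : f ∈ basicSet f A ε := by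
  simp [basicSet, hε]

theorem isOpen_basicSet (f : Cs X) {A : Set X} (hA : A.Countable) (ε : ℝ) :
    IsOpen (basicSet f A ε) := by
  intro g hg
  obtain ⟨r, hr, hr'⟩ := ENNReal.lt_iff_exists_add_pos_lt.mp hg
  refine ⟨A, hA, r, by exact_mod_cast hr, fun h hh => ?_⟩
  simp only [basicSet, Set.mem_ofPred_eq, ENNReal.ofReal_coe_nnreal] at hh ⊢
  refine lt_of_le_of_lt (iSup₂_le fun x hx => ?_) hr'
  exact (edist_triangle _ (g x) _).trans (add_le_add
    (le_iSup₂ (f := fun x (_ : x ∈ A) => edist (f x) (g x)) x hx)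
    ((le_iSup₂ (f := fun x (_ : x ∈ A) => edist (g x) (h x)) x hx).trans hh.le))

theorem isOpen_iff_sUnion {U : Set (Cs X)} :
    IsOpen U ↔ ∃ B : Set (Set (Cs X)),
      (∀ W ∈ B, ∃ (f : Cs X) (A : Set X) (ε : ℝ), A.Countable ∧ 0 < ε ∧ W = basicSet f A ε) ∧
      U = ⋃₀ B := by
  constructor
  · intro hU
    refine ⟨{W | (∃ (f : Cs X) (A : Set X) (ε : ℝ), A.Countable ∧ 0 < ε ∧ W = basicSet f A ε) ∧
      W ⊆ U}, fun W hW => hW.1, Set.Subset.antisymm (fun f hf => ?_)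
      (Set.sUnion_subset fun W hW => hW.2)⟩
    obtain ⟨A, hA, ε, hε, h⟩ := hU f hf
    exact ⟨_, ⟨⟨f, A, ε, hA, hε, rfl⟩, h⟩, mem_basicSet_self f A hε⟩
  · rintro ⟨B, hB, rfl⟩
    refine isOpen_sUnion fun W hW => ?_
    obtain ⟨f, A, ε, hA, -, rfl⟩ := hB W hW
    exact isOpen_basicSet f hA ε

end Cs

-- Upper bound: countable compactness puts each continuous function uniformly close to a rational
-- step function with finitely many ordinal cuts (`exists_step_approx`). Closures of countable sets
-- are countable, so every non-empty open set contains a basic set over a closed countable `A`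
-- centred at such a function. Apart from the cuts, the data are countable. Given more than `ℵ₁`
-- open sets, fix the data; `exists_ne_forall_le_iff_le` then yields two whose cuts are not
-- separated by any point common to their sets `A`. The centres are close there, so Urysohn's lemma
-- (`Cs.basicSet_inter_nonempty`) gives a common element. If `X` is countable, the cuts leave only
-- countably many traces on it, which gives the bound `ℵ₀`.
--
-- Lower bound: an uncountable `X` has uncountably many points with countable initial segments, and
-- the characteristic functions of these segments are centres of disjoint basic sets.

universe v w

/-! ### Infinite combinatorics of cuts and countable sets -/

section Combinatorics

open Cardinal Ordinal

theorem Cardinal.mk_iUnion_le_aleph_one {ι : Type v} {α : Type w} (A : ι → Set α)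
    (hι : Cardinal.lift.{w} #ι ≤ ℵ₁) (hA : ∀ i, #(A i) ≤ ℵ₁) : #(⋃ i, A i) ≤ ℵ₁ := by
  have h := Cardinal.mk_iUnion_le_lift A
  rw [← Cardinal.lift_le.{v}, Cardinal.lift_aleph, Ordinal.lift_one]
  refine h.trans ?_
  refine (mul_le_mul' hι (ciSup_le' fun i => ?_)).trans (Cardinal.mul_eq_self ?_).le
  · simpa using Cardinal.lift_le.{v}.mpr (hA i)
  · exact Cardinal.aleph0_le_aleph 1

theorem Cardinal.mk_biUnion_le_aleph_one {ι : Type v} {α : Type w} {s : Set ι} (hs : s.Countable)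
    (A : ι → Set α) (hA : ∀ i ∈ s, #(A i) ≤ ℵ₁) : #(⋃ i ∈ s, A i : Set α) ≤ ℵ₁ := by
  rw [Set.biUnion_eq_iUnion]
  refine mk_iUnion_le_aleph_one _ ?_ fun i => hA i i.2
  have := hs.to_subtype
  exact (Cardinal.lift_le_aleph0.2 Cardinal.mk_le_aleph0).trans (Cardinal.aleph0_le_aleph 1)

theorem Cardinal.mk_union_le_aleph_one {α : Type w} {s t : Set α} (hs : #s ≤ ℵ₁) (ht : #t ≤ ℵ₁) :
    #(s ∪ t : Set α) ≤ ℵ₁ :=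
  (Cardinal.mk_union_le _ _).trans
    ((add_le_add hs ht).trans (Cardinal.add_eq_self (Cardinal.aleph0_le_aleph 1)).le)

/-- A relation all of whose sections omit at most `ℵ₁` points has increasing chains of
length `ω₁ + 1` on any set with more than `ℵ₁` points. -/
theorem exists_chain_omega_one {I : Type w} (hI : ℵ₁ < #I) (R : I → I → Prop)
    (hR : ∀ i, #{j | ¬ R i j} ≤ ℵ₁) :
    ∃ F : Ordinal.{0} → I, ∀ ξ ≤ ω₁, ∀ η < ξ, R (F η) (F ξ) := by
  classical
  have hne : Nonempty I := Cardinal.mk_ne_zero_iff.1 (bot_le.trans_lt hI).ne'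
  let G : (ξ : Ordinal.{0}) → ((η : Ordinal.{0}) → η < ξ → I) → I := fun ξ f =>
    if h : ∃ j, ∀ η (hη : η < ξ), R (f η hη) j then h.choose else Classical.arbitrary I
  let F : Ordinal.{0} → I := WellFounded.fix (r := (· < ·)) Ordinal.lt_wf G
  have hF : ∀ ξ, F ξ = G ξ fun η _ => F η := fun ξ => WellFounded.fix_eq _ G ξ
  refine ⟨F, fun ξ hξ η hη => ?_⟩
  have hex : ∃ j, ∀ η (_ : η < ξ), R (F η) j := by
    -- Otherwise the at most `ℵ₁` exceptional sets of earlier terms, each of size at most `ℵ₁`,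
    -- would cover `I`; so the default value in `G` is never used up to `ω₁`.
    by_contra! hcon
    have hsub : (Set.univ : Set I) ⊆ ⋃ η : Set.Iio ξ, {j | ¬ R (F η) j} := fun j _ => by
      obtain ⟨η, hη, h⟩ := hcon j
      exact Set.mem_iUnion.2 ⟨⟨η, hη⟩, h⟩
    have hle := (Cardinal.mk_le_mk_of_subset hsub).trans
      (mk_iUnion_le_aleph_one _ ?_ fun η => hR _)
    · rw [Cardinal.mk_univ] at hle
      exact hle.not_gt hI
    · rw [Cardinal.mk_Iio_ordinal, Cardinal.lift_lift]
      have : ξ.card ≤ ℵ₁ := by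
        have := Ordinal.card_le_card hξ
        simpa using this
      simpa using Cardinal.lift_le.2 this
  rw [hF ξ]
  simp only [G, dif_pos hex]
  exact hex.choose_spec η hη

/-- Any family of more than `ℵ₁` bounded ordinals has a large subfamily which either is constant or
has fewer than `ℵ₂` members below any given ordinal smaller than its supremum. -/
theorem exists_subset_const_or_small {I : Type w} (S : Set I) (hS : ℵ₁ < #S)
    (a : I → Ordinal.{u}) {Γ : Ordinal.{u}} (ha : ∀ i, a i ≤ Γ) :
    ∃ T ⊆ S, ℵ₁ < #T ∧ ∃ σ, (∀ τ < σ, #{i ∈ T | a i ≤ τ} ≤ ℵ₁) ∧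
      ((∀ i ∈ T, a i < σ) ∨ ∀ i ∈ T, a i = σ) := by
  have hne : {σ | ℵ₁ < #{i ∈ S | a i ≤ σ}}.Nonempty := by
    refine ⟨Γ, ?_⟩
    simpa [ha] using hS
  -- If more than `ℵ₁` indices take the least such value `σ` exactly, keep those; otherwise discard
  -- them.
  set σ := sInf {σ | ℵ₁ < #{i ∈ S | a i ≤ σ}} with hσ
  have h1 : ℵ₁ < #{i ∈ S | a i ≤ σ} := csInf_mem hne
  have h2 : ∀ τ < σ, #{i ∈ S | a i ≤ τ} ≤ ℵ₁ := fun τ hτ => 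
    not_lt.1 fun h => hτ.not_ge (csInf_le' (s := {σ | ℵ₁ < #{i ∈ S | a i ≤ σ}}) h)
  have hmono : ∀ T ⊆ S, ∀ τ < σ, #{i ∈ T | a i ≤ τ} ≤ ℵ₁ := fun T hT τ hτ =>
    (Cardinal.mk_le_mk_of_subset fun i (hi : i ∈ T ∧ a i ≤ τ) =>
      show i ∈ S ∧ a i ≤ τ from ⟨hT hi.1, hi.2⟩).trans (h2 τ hτ)
  by_cases h : ℵ₁ < #{i ∈ S | a i = σ}
  · exact ⟨_, fun i hi => hi.1, h, σ, hmono _ fun i hi => hi.1, Or.inr fun i hi => hi.2⟩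
  · refine ⟨{i ∈ S | a i < σ}, fun i hi => hi.1, ?_, σ, hmono _ fun i hi => hi.1,
      Or.inl fun i hi => hi.2⟩
    by_contra h'
    refine h1.not_ge ((Cardinal.mk_le_mk_of_subset ?_).trans
      (mk_union_le_aleph_one (not_lt.1 h) (not_lt.1 h')))
    rintro i ⟨hi, hi'⟩
    rcases hi'.lt_or_eq with h | h
    exacts [Or.inr ⟨hi, h⟩, Or.inl ⟨hi, h⟩]

theorem exists_set_const_or_small {I : Type w} (hI : ℵ₁ < #I) {n : ℕ}
    (a : I → Fin n → Ordinal.{u}) {Γ : Ordinal.{u}} (ha : ∀ i k, a i k ≤ Γ) :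
    ∃ T : Set I, ℵ₁ < #T ∧ ∃ σ : Fin n → Ordinal.{u},
      ∀ k, (∀ τ < σ k, #{i ∈ T | a i k ≤ τ} ≤ ℵ₁) ∧
        ((∀ i ∈ T, a i k < σ k) ∨ ∀ i ∈ T, a i k = σ k) := by
  classical
  suffices h : ∀ t : Finset (Fin n), ∃ T : Set I, ℵ₁ < #T ∧ ∀ k ∈ t, ∃ σ,
      (∀ τ < σ, #{i ∈ T | a i k ≤ τ} ≤ ℵ₁) ∧
        ((∀ i ∈ T, a i k < σ) ∨ ∀ i ∈ T, a i k = σ) by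
    obtain ⟨T, hT, h⟩ := h Finset.univ
    choose σ hσ using fun k => h k (Finset.mem_univ k)
    exact ⟨T, hT, σ, hσ⟩
  intro t
  induction t using Finset.induction with
  | empty => exact ⟨Set.univ, by simpa using hI, by simp⟩
  | insert k t _ ih =>
    obtain ⟨S, hS, h⟩ := ih
    obtain ⟨T, hTS, hT, hσ⟩ := exists_subset_const_or_small S hS (fun i => a i k) fun i => ha i k
    refine ⟨T, hT, fun l hl => ?_⟩
    rcases Finset.mem_insert.1 hl with rfl | hl
    · exact hσ
    · obtain ⟨σ, h1, h2⟩ := h l hl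
      exact ⟨σ, fun τ hτ => (Cardinal.mk_le_mk_of_subset fun i (hi : i ∈ T ∧ a i l ≤ τ) =>
        show i ∈ S ∧ a i l ≤ τ from ⟨hTS hi.1, hi.2⟩).trans (h1 τ hτ),
        h2.imp (fun h i hi => h i (hTS hi)) fun h i hi => h i (hTS hi)⟩

/-- Among more than `ℵ₁` pairs of a finite tuple of ordinals and a countable set of ordinals, there
are two whose tuples are not separated by a common element of the two countable sets. -/
theorem exists_ne_forall_le_iff_le {I : Type w} (hI : ℵ₁ < #I) {n : ℕ}
    (a : I → Fin n → Ordinal.{u}) {Γ : Ordinal.{u}} (ha : ∀ i k, a i k ≤ Γ)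
    (A : I → Set Ordinal.{u}) (hA : ∀ i, (A i).Countable) :
    ∃ i j, i ≠ j ∧ ∀ x ∈ A i, x ∈ A j → ∀ k, (a i k ≤ x ↔ a j k ≤ x) := by
  obtain ⟨T, hT, σ, hσ⟩ := exists_set_const_or_small hI a ha
  -- In each non-constant coordinate, the later cut must pass the earlier cut and every element of
  -- the earlier countable set below `σ k`.
  let R : T → T → Prop := fun i j => i ≠ j ∧ ∀ k, (∀ i ∈ T, a i k < σ k) →
    ∀ τ ∈ insert (a i k) (A i), τ < σ k → τ < a j k
  obtain ⟨F, hF⟩ := exists_chain_omega_one hT R fun i => by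
    have hsub : {j | ¬ R i j} ⊆ {i} ∪ ⋃ k, ⋃ τ ∈ insert (a i k) (A i) ∩ Set.Iio (σ k),
        {j : T | a j k ≤ τ} := by
      intro j hj
      by_cases hij : i = j
      · exact Or.inl hij.symm
      · right
        simp only [R, Set.mem_ofPred_eq, ne_eq, hij, not_false_eq_true, true_and] at hj
        push Not at hj
        obtain ⟨k, -, τ, h1, h2, h3⟩ := hj
        exact Set.mem_iUnion.2 ⟨k, Set.mem_biUnion ⟨h1, h2⟩ h3⟩
    refine (Cardinal.mk_le_mk_of_subset hsub).trans (mk_union_le_aleph_one ?_ ?_)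
    · rw [Cardinal.mk_singleton]
      exact Cardinal.one_le_aleph0.trans (Cardinal.aleph0_le_aleph 1)
    · refine mk_iUnion_le_aleph_one _ ?_ fun k => mk_biUnion_le_aleph_one
        (((hA i).insert _).mono Set.inter_subset_left) _ fun τ hτ => ?_
      · exact (Cardinal.lift_le_aleph0.2 Cardinal.mk_le_aleph0).trans (Cardinal.aleph0_le_aleph 1)
      · refine le_trans ?_ ((hσ k).1 τ hτ.2)
        rw [← Cardinal.mk_image_eq (f := ((↑) : T → I)) Subtype.val_injective]
        refine Cardinal.mk_le_mk_of_subset ?_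
        rintro _ ⟨j, hj, rfl⟩
        exact ⟨j.2, hj⟩
  classical
  let j := F ω₁
  -- `g k x` is a stage below `ω₁` whose cut exceeds `x`, if one exists. Countably many such stages,
  -- for `x ∈ A j`, have a common bound `ζ < ω₁`, and `F ζ` is paired with `j`.
  let g : Fin n → Ordinal.{u} → Ordinal.{0} := fun k x =>
    if h : ∃ ξ < ω₁, x < a (F ξ) k then h.choose else 0
  have hg : ∀ k x, g k x < ω₁ := fun k x => by
    by_cases h : ∃ ξ < ω₁, x < a (F ξ) k
    · simpa only [g, dif_pos h] using h.choose_spec.1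
    · simpa only [g, dif_neg h] using Ordinal.omega_pos 1
  have hgs : ∀ k x, (∃ ξ < ω₁, x < a (F ξ) k) → x < a (F (g k x)) k := fun k x h => by
    simpa only [g, dif_pos h] using h.choose_spec.2
  have : Countable (A j) := (hA j).to_subtype
  obtain ⟨ζ, hζ, hgζ⟩ : ∃ ζ < ω₁, ∀ k, ∀ x ∈ A j, g k x ≤ ζ := by
    refine ⟨⨆ p : Fin n × A j, g p.1 p.2, ?_, fun k x hx => ?_⟩
    · exact Ordinal.iSup_lt_omega_one fun p => hg _ _
    · exact le_ciSup (f := fun p : Fin n × A j => g p.1 p.2) Ordinal.bddAbove_of_small (k, ⟨x, hx⟩)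
  have hζj := hF ω₁ le_rfl ζ hζ
  refine ⟨F ζ, j, fun h => hζj.1 (Subtype.ext h), fun x hxi hxj k => ?_⟩
  rcases (hσ k).2 with hk | hk
  · constructor
    · intro hx
      by_contra! hxj'
      -- Since `x` is in the set of `F ζ`, stage `ζ + 1` passes `x`. Hence stage `g k x ≤ ζ` passes
      -- it too, and by monotonicity so does `ζ`: a contradiction.
      have hlim : ζ + 1 < ω₁ := (Cardinal.isSuccLimit_omega 1).add_one_lt hζ
      have h1 := (hF (ζ + 1) hlim.le ζ (lt_add_one ζ)).2 k hk x (Or.inr hxi)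
        (hxj'.trans (hk _ j.2))
      have h2 := hgs k x ⟨_, hlim, h1⟩
      rcases (hgζ k x hxj).lt_or_eq with h | h
      · exact (h2.trans ((hF ζ hζ.le _ h).2 k hk _ (Or.inl rfl) (hk _ (F _).2))).not_ge hx
      · rw [h] at h2
        exact h2.not_ge hx
    · exact fun hx => (hζj.2 k hk _ (Or.inl rfl) (hk _ (F ζ).2)).le.trans hx
  · rw [hk _ (F ζ).2, hk _ j.2]

end Combinatorics

/-! ### Step approximation and gluing of continuous functions -/

section StepFunctions

open Set Filter Topology

theorem Ordinal.isLUB_of_mem_closure {A : Set Ordinal.{u}} {x : Ordinal.{u}} (hx : x ∈ closure A)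
    (hxA : x ∉ A) : (A ∩ Iio x).Nonempty ∧ IsLUB (A ∩ Iio x) x := by
  have key : ∀ b < x, ∃ a ∈ A ∩ Iio x, b < a := fun b hb => by
    obtain ⟨a, ⟨h1, h2⟩, h3⟩ := mem_closure_iff.1 hx (Ioo b (x + 1)) isOpen_Ioo
      ⟨hb, lt_add_one x⟩
    exact ⟨a, ⟨h3, (Order.lt_add_one_iff.1 h2).lt_of_ne fun h => hxA (h ▸ h3)⟩, h1⟩
  refine ⟨?_, fun a ha => ha.2.le, fun b hb => not_lt.1 fun h => ?_⟩
  · obtain ⟨a, h1, h2⟩ := mem_closure_iff.1 hx (Iio (x + 1)) isOpen_Iio (lt_add_one x)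
    exact ⟨a, h2, (Order.lt_add_one_iff.1 h1 : a ≤ x).lt_of_ne fun h => hxA (h ▸ h2)⟩
  · obtain ⟨a, ha, h'⟩ := key b h
    exact h'.not_ge (hb ha)

/-- A limit point outside `A` is the supremum of the part of `A` below it, which is determined by
the least element of `A` above the point, or is all of `A`. -/
theorem Ordinal.countable_closure {A : Set Ordinal.{u}} (hA : A.Countable) :
    (closure A).Countable := by
  refine ((hA.union (hA.image fun a => sSup (A ∩ Iio a))).insert (sSup A)).mono fun x hx => ?_
  by_cases hxA : x ∈ A
  · exact Or.inr (Or.inl hxA)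
  obtain ⟨hne, hlub⟩ := isLUB_of_mem_closure hx hxA
  rw [← hlub.csSup_eq hne]
  by_cases h : ∃ a ∈ A, x < a
  · refine Or.inr (Or.inr ?_)
    have hm : sInf {a ∈ A | x < a} ∈ {a ∈ A | x < a} := csInf_mem h
    refine ⟨_, hm.1, congrArg sSup (Subset.antisymm (fun a ha => ⟨ha.1, ?_⟩) fun a ha =>
      ⟨ha.1, lt_trans ha.2 hm.2⟩)⟩
    have h1 : a ≤ x := not_lt.1 fun h =>
      (mem_Iio.1 ha.2).not_ge (csInf_le' (s := {a ∈ A | x < a}) ⟨ha.1, h⟩)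
    exact h1.lt_of_ne fun h => hxA (h ▸ ha.1)
  · push Not at h
    refine Or.inl (congrArg sSup (inter_eq_left.2 fun a ha => ?_))
    exact (h a ha).lt_of_ne fun h => hxA (h ▸ ha)

theorem countable_closure_of_subtype {X : Set Ordinal.{u}} {A : Set X} (hA : A.Countable) :
    (closure A).Countable := by
  have h := (Ordinal.countable_closure (hA.image Subtype.val)).mono
    (image_closure_subset_closure_image (s := A) continuous_subtype_val)
  exact Set.countable_of_injective_of_countable_image Subtype.val_injective.injOn h

theorem MapClusterPt.eq_of_tendsto {α : Type*} {E : Type*} [TopologicalSpace E] [T2Space E]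
    {l : Filter α} {u : α → E} {a s : E} (h : MapClusterPt a l u) (hs : Tendsto u l (𝓝 s)) :
    a = s := by
  have : (𝓝 a ⊓ 𝓝 s).NeBot := h.clusterPt.mono hs
  exact eq_of_nhds_neBot this

variable {X : Set Ordinal.{u}}

/-- Below each point, a continuous function on a countably compact set of ordinals has small
oscillation on some final segment. -/
theorem exists_lt_forall_abs_sub_le (hX : IsCountablyCompact X) (f : C(X, ℝ)) {ε : ℝ} (hε : 0 < ε)
    {p : Ordinal.{u}} (hp : 0 < p) :
    ∃ q < p, ∀ x y : X, q ≤ x → x < p → q ≤ y → y < p → |f x - f y| ≤ ε := by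
  by_contra! hcon
  choose x y hx hxp hy hyp hxy using fun q : Iio p => hcon q q.2
  -- Each term is the larger of the two bad points chosen beyond the previous one. The bad points
  -- interlace with `z`, so both sequences tend to its supremum; countable compactness puts it in
  -- `X`, where continuity fails.
  let z : ℕ → Iio p := fun n => Nat.rec ⟨0, hp⟩
    (fun _ q => ⟨max (x q) (y q), max_lt (hxp q) (hyp q)⟩) n
  have hzs : ∀ n, (z (n + 1)).1 = max (x (z n) : Ordinal.{u}) (y (z n)) := fun n => rfl
  have hmono : Monotone fun n => (z n).1 := 
    monotone_nat_of_le_succ (f := fun n => (z n).1) fun n =>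
      (hx (z n)).trans (le_max_left (x (z n) : Ordinal.{u}) (y (z n)))
  have hz : Tendsto (fun n => (z n).1) atTop (𝓝 (⨆ n, (z n).1)) :=
    tendsto_atTop_ciSup hmono ⟨p, by rintro _ ⟨n, rfl⟩; exact (z n).2.le⟩
  have hz' := hz.comp (tendsto_add_atTop_nat 1)
  have hxt : Tendsto (fun n => (x (z n) : Ordinal.{u})) atTop (𝓝 (⨆ n, (z n).1)) :=
    tendsto_of_tendsto_of_tendsto_of_le_of_le hz hz' (fun n => hx _) fun n => by
      simp only [Function.comp_apply, hzs]; exact le_max_left _ _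
  have hyt : Tendsto (fun n => (y (z n) : Ordinal.{u})) atTop (𝓝 (⨆ n, (z n).1)) :=
    tendsto_of_tendsto_of_tendsto_of_le_of_le hz hz' (fun n => hy _) fun n => by
      simp only [Function.comp_apply, hzs]; exact le_max_right _ _
  obtain ⟨s, hs, hclus⟩ := hX.seq_clusterPt (fun n => (x (z n) : Ordinal.{u}))
    (Eventually.of_forall fun n => (x (z n)).2)
  have hs' := hclus.eq_of_tendsto hxt
  rw [← hs'] at hxt hyt
  have hfx := (f.continuous.tendsto ⟨s, hs⟩).comp
    (tendsto_subtype_rng.2 hxt : Tendsto (fun n => x (z n)) atTop (𝓝 ⟨s, hs⟩))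
  have hfy := (f.continuous.tendsto ⟨s, hs⟩).comp
    (tendsto_subtype_rng.2 hyt : Tendsto (fun n => y (z n)) atTop (𝓝 ⟨s, hs⟩))
  have hlim := (hfx.sub hfy).abs
  rw [sub_self, abs_zero] at hlim
  exact hε.not_ge (ge_of_tendsto' hlim fun n => (hxy (z n)).le)

/-- Well-founded induction on `p`: the oscillation bound handles a final segment `[q, p)`, and `q`
joins the cuts obtained below `q`. -/
theorem exists_finset_forall_abs_sub_le (hX : IsCountablyCompact X) (f : C(X, ℝ)) {ε : ℝ}
    (hε : 0 < ε) (p : Ordinal.{u}) :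
    ∃ C : Finset Ordinal.{u}, (∀ c ∈ C, c < p) ∧ ∀ x y : X, x < p → y < p →
      (∀ c ∈ C, c ≤ x ↔ c ≤ y) → |f x - f y| ≤ ε := by
  classical
  induction p using WellFoundedLT.induction with
  | ind p ih =>
    rcases eq_zero_or_pos p with rfl | hp
    · exact ⟨∅, by simp, fun x _ hx => absurd hx not_lt_zero⟩
    · obtain ⟨q, hq, hosc⟩ := exists_lt_forall_abs_sub_le hX f hε hp
      obtain ⟨C, hC, hCf⟩ := ih q hq
      refine ⟨insert q C, ?_, fun x y hx hy h => ?_⟩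
      · simp only [Finset.mem_insert, forall_eq_or_imp]
        exact ⟨hq, fun c hc => (hC c hc).trans hq⟩
      · have hqxy := h q (Finset.mem_insert_self _ _)
        by_cases hqx : q ≤ x
        · exact hosc x y hqx hx (hqxy.1 hqx) hy
        · exact hCf x y (not_le.1 hqx) (not_le.1 (mt hqxy.2 hqx))
            fun c hc => h c (Finset.mem_insert_of_mem hc)

/-- A continuous function on a countably compact bounded set of ordinals is uniformly approximated
by a rational step function with finitely many steps. -/
theorem exists_step_approx (hX : IsCountablyCompact X) {γ : Ordinal.{u}} (hXγ : X ⊆ Iic γ)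
    (f : C(X, ℝ)) {ε : ℝ} (hε : 0 < ε) :
    ∃ (n : ℕ) (a : Fin n → Ordinal.{u}) (q : Set (Fin n) → ℚ), (∀ k, a k ≤ γ) ∧
      ∀ x : X, |f x - q {k | a k ≤ x}| < ε := by
  classical
  obtain ⟨C, hC, hCf⟩ := exists_finset_forall_abs_sub_le hX f (half_pos hε) (γ + 1)
  let a : Fin C.card → Ordinal.{u} := fun k => C.equivFin.symm k
  have hr : ∀ P : Set (Fin C.card), ∃ r : ℚ, ∀ y : X, {k | a k ≤ y} = P → |f y - r| < ε := by
    intro P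
    by_cases h : ∃ y : X, {k | a k ≤ y} = P
    · obtain ⟨x, hx⟩ := h
      obtain ⟨r, hr⟩ := exists_rat_near (f x) (half_pos hε)
      refine ⟨r, fun y hy => ?_⟩
      have hyx := hCf y x (Order.lt_add_one_iff.2 (hXγ y.2)) (Order.lt_add_one_iff.2 (hXγ x.2))
        fun c hc => by
          have := Set.ext_iff.1 (hy.trans hx.symm) (C.equivFin ⟨c, hc⟩)
          simpa [a] using this
      calc |f y - r| = |(f y - f x) + (f x - r)| := by ring_nf
        _ ≤ |f y - f x| + |f x - r| := abs_add_le _ _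
        _ < ε := by linarith
    · exact ⟨0, fun y hy => absurd ⟨y, hy⟩ h⟩
  choose q hq using hr
  exact ⟨_, a, q, fun k => Order.lt_add_one_iff.1 (hC _ (C.equivFin.symm k).2),
    fun x => hq _ x rfl⟩

namespace Cs

theorem mem_basicSet_of_le {X : Type u} [TopologicalSpace X] {f g : Cs X} {A : Set X} {δ ε : ℝ}
    (h : ∀ x ∈ A, |f x - g x| ≤ δ) (hδ : δ < ε) (hε : 0 < ε) : g ∈ basicSet f A ε := by
  refine lt_of_le_of_lt (iSup₂_le fun x hx => ?_) ((ENNReal.ofReal_lt_ofReal_iff hε).2 hδ)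
  rw [edist_dist, Real.dist_eq]
  exact ENNReal.ofReal_le_ofReal (h x hx)

theorem abs_sub_lt_of_mem_basicSet {X : Type u} [TopologicalSpace X] {f g : Cs X} {A : Set X}
    {ε : ℝ} (h : g ∈ basicSet f A ε) {x : X} (hx : x ∈ A) : |f x - g x| < ε := by
  have h1 := (le_iSup₂ (f := fun x (_ : x ∈ A) => edist (f x) (g x)) x hx).trans_lt h
  rw [edist_dist, Real.dist_eq] at h1
  exact (ENNReal.ofReal_lt_ofReal_iff_of_nonneg (abs_nonneg _)).1 h1

theorem basicSet_anti {X : Type u} [TopologicalSpace X] (f : Cs X) {A B : Set X} (h : A ⊆ B)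
    {ε δ : ℝ} (hεδ : ε ≤ δ) : basicSet f B ε ⊆ basicSet f A δ := fun _ hg =>
  ((biSup_mono h).trans_lt hg).trans_le (ENNReal.ofReal_le_ofReal hεδ)

/-- Two basic sets over closed sets of a normal space meet if their centres are close on the
intersection of the closed sets. -/
theorem basicSet_inter_nonempty {X : Type u} [TopologicalSpace X] [NormalSpace X] {f g : Cs X}
    {A B : Set X} (hA : IsClosed A) (hB : IsClosed B) {δ ε : ℝ}
    (h : ∀ x ∈ A, x ∈ B → |f x - g x| < δ) (hδ : 0 < δ) (hε : δ < ε) :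
    (basicSet f A ε ∩ basicSet g B ε).Nonempty := by
  let f' : C(X, ℝ) := f
  let g' : C(X, ℝ) := g
  have hcl : IsClosed {x ∈ B | δ ≤ |f' x - g' x|} :=
    hB.inter (isClosed_le continuous_const (f'.continuous.sub g'.continuous).abs)
  -- The interpolation `k` equals `f` on `A`; on `B` it equals `g` except where `f` and `g` already
  -- differ by less than `δ`.
  obtain ⟨φ, h0, h1, hφ⟩ := exists_continuous_zero_one_of_isClosed hA hcl
    (Set.disjoint_left.2 fun x hx hx' => (h x hx hx'.1).not_ge hx'.2)
  let k : C(X, ℝ) := f' + φ * (g' - f')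
  have hk : ∀ x, k x = f' x + φ x * (g' x - f' x) := fun x => rfl
  refine ⟨k, mem_basicSet_of_le (δ := 0) (fun x hx => ?_) (hδ.trans hε) (hδ.trans hε),
    mem_basicSet_of_le (δ := δ) (fun x hx => ?_) hε (hδ.trans hε)⟩
  · change |f' x - k x| ≤ 0
    rw [hk, h0 hx]
    simp
  · change |g' x - k x| ≤ δ
    have he : g' x - k x = (1 - φ x) * (g' x - f' x) := by rw [hk]; ring
    rw [he]
    by_cases hx' : δ ≤ |f' x - g' x|
    · rw [h1 ⟨hx, hx'⟩]
      simpa using hδ.le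
    · rw [abs_mul, abs_sub_comm (g' x)]
      have h2 : |1 - φ x| ≤ 1 := abs_le.2 ⟨by linarith [(hφ x).2], by linarith [(hφ x).1]⟩
      nlinarith [abs_nonneg (1 - φ x), abs_nonneg (f' x - g' x)]

end Cs

end StepFunctions

/-! ### Bounds on cellularity -/

section Bounds

open Cardinal Ordinal Set Filter Topology

section Cellularity

variable {Y : Type u} [TopologicalSpace Y]

theorem cellularity_spec :
    ℵ₀ ≤ cellularity Y ∧ ∀ F : Set (Set Y), IsCellularFamily F → #F ≤ cellularity Y :=
  csInf_mem (s := {κ : Cardinal.{u} | ℵ₀ ≤ κ ∧ ∀ F : Set (Set Y), IsCellularFamily F → #F ≤ κ})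
    ⟨max ℵ₀ #(Set Y), le_max_left _ _, fun F _ => (Cardinal.mk_set_le F).trans (le_max_right _ _)⟩

theorem cellularity_le {κ : Cardinal.{u}} (hκ : ℵ₀ ≤ κ)
    (h : ∀ F : Set (Set Y), IsCellularFamily F → #F ≤ κ) : cellularity Y ≤ κ :=
  csInf_le' ⟨hκ, h⟩

theorem IsCellularFamily.eq_of_inter_nonempty {F : Set (Set Y)} (hF : IsCellularFamily F)
    {U V : Set Y} (hU : U ∈ F) (hV : V ∈ F) (h : (U ∩ V).Nonempty) : U = V := by
  by_contra hne
  exact Set.not_disjoint_iff_nonempty_inter.2 h (hF.2 hU hV hne)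

end Cellularity

namespace Cs

variable {X : Set Ordinal.{u}}

/-- Finite combinatorial data describing a rational step function up to the position of its cuts:
the number of cuts, the precision `1 / (m + 1)`, and the values. -/
abbrev StepData : Type := Σ n : ℕ, ℕ × (Set (Fin n) → ℚ)

/-- The radius has numerator 3 because centres with the same step value differ by less than `2 / (m
+ 1)`, so gluing keeps some slack. -/
theorem exists_stepData (hX : IsCountablyCompact X) {γ : Ordinal.{u}} (hXγ : X ⊆ Iic γ)
    {U : Set (Cs X)} (hU : IsOpen U) (hne : U.Nonempty) :
    ∃ (d : StepData) (a : Fin d.1 → Ordinal.{u}) (f : Cs X) (A : Set X),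
      (∀ k, a k ≤ γ) ∧ A.Countable ∧ IsClosed A ∧
      (∀ x : X, |f x - d.2.2 {k | a k ≤ x}| < 1 / (d.2.1 + 1)) ∧
      basicSet f A (3 / (d.2.1 + 1)) ⊆ U := by
  obtain ⟨f, hf⟩ := hne
  obtain ⟨A, hA, ε, hε, hAU⟩ := hU f hf
  obtain ⟨m, hm⟩ := exists_nat_one_div_lt (show 0 < ε / 3 by positivity)
  obtain ⟨n, a, q, ha, hq⟩ := exists_step_approx hX hXγ f (Nat.one_div_pos_of_nat (n := m))
  refine ⟨⟨n, m, q⟩, a, f, closure A, ha, countable_closure_of_subtype hA, isClosed_closure, hq,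
    (basicSet_anti f subset_closure ?_).trans hAU⟩
  have : (3 : ℝ) / (m + 1) = 3 * (1 / (m + 1)) := by ring
  change (3 : ℝ) / (m + 1) ≤ ε
  linarith

theorem mk_le_aleph_one_of_isCellularFamily (hX : IsCountablyCompact X) {γ : Ordinal.{u}}
    (hXγ : X ⊆ Iic γ) {F : Set (Set (Cs X))} (hF : IsCellularFamily F) : #F ≤ ℵ₁ := by
  choose d hd using fun U : F => exists_stepData hX hXγ (hF.1 U U.2).1 (hF.1 U U.2).2
  by_contra! hlt
  obtain ⟨d₀, hd₀⟩ : ∃ d₀, ℵ₁ < #{U | d U = d₀} := by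
    by_contra! h
    refine hlt.not_ge ?_
    rw [← Cardinal.mk_univ (α := F)]
    refine (Cardinal.mk_le_mk_of_subset fun U _ => mem_iUnion.2 ⟨d U, rfl⟩).trans
      (mk_iUnion_le_aleph_one (fun d₀ => {U | d U = d₀}) ?_ h)
    exact (Cardinal.lift_le_aleph0.2 Cardinal.mk_le_aleph0).trans (Cardinal.aleph0_le_aleph 1)
  have hI : ∀ U : {U | d U = d₀}, ∃ (a : Fin d₀.1 → Ordinal.{u}) (f : Cs X) (A : Set X),
      (∀ k, a k ≤ γ) ∧ A.Countable ∧ IsClosed A ∧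
      (∀ x : X, |f x - d₀.2.2 {k | a k ≤ x}| < 1 / (d₀.2.1 + 1)) ∧
      basicSet f A (3 / (d₀.2.1 + 1)) ⊆ U.1 := by
    rintro ⟨U, rfl⟩
    exact hd U
  choose a f A ha hA hAc hfa hfU using hI
  obtain ⟨U, V, hUV, h⟩ := exists_ne_forall_le_iff_le hd₀ a ha (fun U => Subtype.val '' A U)
    fun U => (hA U).image _
  have hpos : (0 : ℝ) < 1 / (d₀.2.1 + 1) := Nat.one_div_pos_of_nat
  have hne := basicSet_inter_nonempty (f := f U) (g := f V) (hAc U) (hAc V)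
    (δ := 2 * (1 / (d₀.2.1 + 1))) (ε := 3 / (d₀.2.1 + 1)) (fun x hxU hxV => ?_) (by linarith)
    (by rw [div_eq_mul_one_div (3 : ℝ)]; linarith)
  · exact hUV (Subtype.ext (Subtype.ext (hF.eq_of_inter_nonempty U.1.2 V.1.2
      (hne.mono (inter_subset_inter (hfU U) (hfU V))))))
  · have hpat : {k | a U k ≤ x} = {k | a V k ≤ x} :=
      Set.ext fun k => h x (mem_image_of_mem _ hxU) (mem_image_of_mem _ hxV) k
    have h1 := abs_lt.1 (hfa U x)
    have h2 := abs_lt.1 (hfa V x)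
    rw [hpat] at h1
    exact abs_lt.2 ⟨by linarith, by linarith⟩

/-- A non-empty final segment is determined by its least element. -/
theorem countable_setOf_le (hX : X.Countable) :
    {s : Set X | ∃ c : Ordinal.{u}, s = {x : X | c ≤ x}}.Countable := by
  have := hX.to_subtype
  refine (((countable_range fun y : X => {x : X | y ≤ x})).insert ∅).mono ?_
  rintro _ ⟨c, rfl⟩
  by_cases h : ∃ x : X, c ≤ x
  · refine Or.inr ⟨WellFounded.min (r := (· < ·)) wellFounded_lt {x : X | c ≤ x} h, ?_⟩
    have hmem := WellFounded.min_mem (r := (· < ·)) wellFounded_lt {x : X | c ≤ x} h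
    ext x
    exact ⟨fun hx => show c ≤ x from le_trans hmem hx,
      fun hx => not_lt.1 (WellFounded.not_lt_min wellFounded_lt {x : X | c ≤ x} hx)⟩
  · refine Or.inl (eq_empty_of_forall_notMem fun x hx => h ⟨x, hx⟩)

theorem mk_le_aleph0_of_isCellularFamily (hX : IsCountablyCompact X) {γ : Ordinal.{u}}
    (hXγ : X ⊆ Iic γ) (hXc : X.Countable) {F : Set (Set (Cs X))} (hF : IsCellularFamily F) :
    #F ≤ ℵ₀ := by
  let C := {s : Set X | ∃ c : Ordinal.{u}, s = {x : X | c ≤ x}}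
  have : Countable C := (countable_setOf_le hXc).to_subtype
  have hd : ∀ U : F, ∃ (e : Σ n : ℕ, (ℕ × (Set (Fin n) → ℚ)) × (Fin n → C)) (f : Cs X) (A : Set X),
      (∀ x : X, |f x - e.2.1.2 {k | x ∈ (e.2.2 k : Set X)}| < 1 / (e.2.1.1 + 1)) ∧
      basicSet f A (3 / (e.2.1.1 + 1)) ⊆ U := fun U => by
    obtain ⟨⟨n, m, q⟩, a, f, A, -, -, -, hfa, hfU⟩ :=
      exists_stepData hX hXγ (hF.1 U U.2).1 (hF.1 U U.2).2
    exact ⟨⟨n, (m, q), fun k => ⟨{x | a k ≤ x}, a k, rfl⟩⟩, f, A, hfa, hfU⟩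
  choose e f A hfe hfU using hd
  -- Equal data make the centres close on all of `X`, so one centre lies in both basic sets and no
  -- gluing is needed.
  have hinj : Function.Injective e := fun U V hUV => by
    have hV := hfe V
    have hVU := hfU V
    rw [← hUV] at hV hVU
    have hpos : (0 : ℝ) < 1 / ((e U).2.1.1 + 1) := Nat.one_div_pos_of_nat
    have h3 : (3 : ℝ) / ((e U).2.1.1 + 1) = 3 * (1 / ((e U).2.1.1 + 1)) := div_eq_mul_one_div _ _
    refine Subtype.ext (hF.eq_of_inter_nonempty U.2 V.2 ⟨f V, hfU U ?_, hVU ?_⟩)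
    · refine mem_basicSet_of_le (δ := 2 * (1 / ((e U).2.1.1 + 1))) (fun x _ => ?_)
        (by linarith) (by linarith)
      have h1 := abs_lt.1 (hfe U x)
      have h2 := abs_lt.1 (hV x)
      exact abs_le.2 ⟨by linarith, by linarith⟩
    · exact mem_basicSet_self _ _ (by linarith)
  exact Cardinal.mk_le_aleph0_iff.2 hinj.countable

theorem not_countable_setOf_countable_Iic (hX : ¬ X.Countable) :
    ¬ {a ∈ X | (X ∩ Iic a).Countable}.Countable := by
  intro hS
  by_cases h : ∃ a ∈ X, ¬ (X ∩ Iic a).Countable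
  · have hm : sInf {a ∈ X | ¬ (X ∩ Iic a).Countable} ∈ {a ∈ X | ¬ (X ∩ Iic a).Countable} :=
      csInf_mem h
    -- All points of `X` below the least one with an uncountable initial segment belong to the set
    -- assumed countable.
    refine hm.2 ((hS.insert (sInf {a ∈ X | ¬ (X ∩ Iic a).Countable})).mono fun x hx => ?_)
    rcases (mem_Iic.1 hx.2).lt_or_eq with h | h
    · refine Or.inr ⟨hx.1, ?_⟩
      by_contra hx'
      exact h.not_ge (csInf_le' (s := {a ∈ X | ¬ (X ∩ Iic a).Countable}) ⟨hx.1, hx'⟩)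
    · exact Or.inl h
  · push Not at h
    exact hX (hS.mono fun a ha => show a ∈ X ∧ (X ∩ Iic a).Countable from ⟨ha, h a ha⟩)

/-- The characteristic function of the clopen initial segment of `X` ending at `a`. -/
noncomputable def charIic (X : Set Ordinal.{u}) (a : Ordinal.{u}) : Cs X where
  toFun := {x : X | (x : Ordinal.{u}) ≤ a}.indicator 1
  continuous_toFun := by
    have h : IsClopen (Iic a) := ⟨isClosed_Iic, by rw [← Order.Iio_succ]; exact isOpen_Iio⟩
    have h' : IsClopen {x : X | (x : Ordinal.{u}) ≤ a} := h.preimage continuous_subtype_val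
    exact continuous_one.indicator fun x hx => by simp [h'.frontier_eq] at hx

theorem charIic_of_le {a : Ordinal.{u}} {x : X} (h : (x : Ordinal.{u}) ≤ a) : charIic X a x = 1 :=
  indicator_of_mem (s := {x : X | (x : Ordinal.{u}) ≤ a}) h 1

theorem charIic_of_lt {a : Ordinal.{u}} {x : X} (h : a < x) : charIic X a x = 0 :=
  indicator_of_notMem (s := {x : X | (x : Ordinal.{u}) ≤ a}) (not_le.2 h) 1

/-- With `s a` the successor of `a` in `X`, members of `W a` are below `1/2` at `s a`. For `b > a`,
`s a ≤ b`, so members of `W b` exceed `1/2` there. -/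
theorem aleph_one_le_cellularity (hX : ¬ X.Countable) : ℵ₁ ≤ cellularity (Cs X) := by
  set S := {a ∈ X | (X ∩ Iic a).Countable} with hS
  have hSu := not_countable_setOf_countable_Iic hX
  have hnext : ∀ a : S, ∃ b : X, a.1 < b ∧ ∀ c ∈ X, a.1 < c → b ≤ c := fun a => by
    have hne : {b ∈ X | a.1 < b}.Nonempty := by
      by_contra hcon
      refine hSu (a.2.2.mono fun b hb =>
        show b ∈ X ∧ b ≤ a.1 from ⟨hb.1, not_lt.1 fun h => hcon ⟨b, hb.1, h⟩⟩)
    have hm := csInf_mem hne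
    exact ⟨⟨_, hm.1⟩, hm.2, fun c hc hac => csInf_le' (s := {b ∈ X | a.1 < b}) ⟨hc, hac⟩⟩
  choose s hs hsmin using hnext
  let W : S → Set (Cs X) := fun a =>
    basicSet (charIic X a) (insert (s a) {x : X | (x : Ordinal.{u}) ≤ a}) (1 / 2)
  have hdisj : ∀ a b : S, a < b → Disjoint (W a) (W b) := fun a b hab => by
    refine disjoint_left.2 fun g hga hgb => ?_
    have h1 := abs_lt.1 (abs_sub_lt_of_mem_basicSet hga (x := s a) (Or.inl rfl))
    have hle : (s a : Ordinal.{u}) ≤ b := hsmin a b b.2.1 hab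
    have h2 := abs_lt.1 (abs_sub_lt_of_mem_basicSet hgb (x := s a) (Or.inr hle))
    rw [charIic_of_lt (hs a)] at h1
    rw [charIic_of_le hle] at h2
    linarith
  have hmem : ∀ a, charIic X a ∈ W a := fun a => mem_basicSet_self _ _ (by norm_num)
  have hdisj' : ∀ a b : S, a ≠ b → Disjoint (W a) (W b) := fun a b hab =>
    hab.lt_or_gt.elim (hdisj a b) fun h => (hdisj b a h).symm
  have hinj : Function.Injective W := fun a b hab => by
    by_contra hne
    exact disjoint_left.1 (hdisj' a b hne) (hmem a) (hab ▸ hmem a)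
  have hcell : IsCellularFamily (range W) := by
    refine ⟨?_, ?_⟩
    · rintro _ ⟨a, rfl⟩
      refine ⟨isOpen_basicSet _ (Countable.insert _ ?_) _, _, hmem a⟩
      refine countable_of_injective_of_countable_image (f := Subtype.val)
        Subtype.val_injective.injOn (a.2.2.mono ?_)
      rintro _ ⟨x, hx, rfl⟩
      exact ⟨x.2, hx⟩
    · rintro _ ⟨a, rfl⟩ _ ⟨b, rfl⟩ hne
      exact hdisj' a b fun h => hne (h ▸ rfl)
  have h := cellularity_spec.2 _ hcell
  rw [Cardinal.mk_range_eq W hinj] at h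
  refine le_trans ?_ h
  rw [← Cardinal.succ_aleph0, Order.succ_le_iff, ← not_le, Cardinal.le_aleph0_iff_set_countable]
  exact hSu

theorem cellularity_eq_aleph0 (hX : IsCountablyCompact X) {γ : Ordinal.{u}} (hXγ : X ⊆ Iic γ)
    (hXc : X.Countable) : cellularity (Cs X) = ℵ₀ :=
  (cellularity_le le_rfl fun _ hF => mk_le_aleph0_of_isCellularFamily hX hXγ hXc hF).antisymm
    cellularity_spec.1

theorem cellularity_eq_aleph_one (hX : IsCountablyCompact X) {γ : Ordinal.{u}} (hXγ : X ⊆ Iic γ)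
    (hXc : ¬ X.Countable) : cellularity (Cs X) = ℵ₁ :=
  (cellularity_le (aleph0_le_aleph 1) fun _ hF =>
    mk_le_aleph_one_of_isCellularFamily hX hXγ hF).antisymm (aleph_one_le_cellularity hXc)

end Cs

/-- Uncountable cofinality bounds a tail of the sequence below `γ`, placing it in a compact
interval. -/
theorem Ordinal.isCountablyCompact_Iio {γ : Ordinal.{u}} (hγ : ℵ₀ < γ.cof) :
    IsCountablyCompact (Iio γ) := by
  refine IsCountablyCompact.of_seq_clusterPt fun x hx => ?_
  obtain ⟨N, hN⟩ := eventually_atTop.1 hx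
  have hs : ⨆ n, x (n + N) < γ :=
    Ordinal.lift_iSup_lt_of_lt_cof (by simpa using hγ) fun n => hN _ (Nat.le_add_left _ _)
  have hle : ∀ n ≥ N, x n ∈ Icc 0 (⨆ n, x (n + N)) := fun n hn => by
    obtain ⟨k, rfl⟩ := Nat.exists_eq_add_of_le' hn
    exact ⟨zero_le, le_ciSup (f := fun n => x (n + N)) Ordinal.bddAbove_of_small k⟩
  obtain ⟨a, ha, h⟩ :=
    isCompact_Icc.isCountablyCompact.seq_clusterPt x (eventually_atTop.2 ⟨N, hle⟩)
  exact ⟨a, ha.2.trans_lt hs, h⟩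

theorem Ordinal.not_countable_Iio {γ : Ordinal.{u}} (hγ : ℵ₀ < γ.cof) : ¬ (Iio γ).Countable := by
  rw [← Cardinal.le_aleph0_iff_set_countable, Cardinal.mk_Iio_ordinal, Cardinal.lift_le_aleph0,
    not_le]
  exact hγ.trans_le γ.cof_le_card

end Bounds

theorem mainTheorem5 (γ : Ordinal.{u}) :
    (∀ X : Set Ordinal.{u}, X ⊆ Set.Iic γ → IsCountablyCompact X →
      (cellularity (Cs X) = Cardinal.aleph0 ↔ IsCompact X ∧ X.Countable) ∧
      (cellularity (Cs X) = Cardinal.aleph 1 ↔ ¬ X.Countable)) ∧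
    (Cardinal.aleph0 < γ.cof → cellularity (Cs (Set.Iio γ)) = Cardinal.aleph 1) := by
  refine ⟨fun X hXγ hX => ?_, fun hγ => Cs.cellularity_eq_aleph_one
    (Ordinal.isCountablyCompact_Iio hγ) Set.Iio_subset_Iic_self (Ordinal.not_countable_Iio hγ)⟩
  by_cases hXc : X.Countable
  · have h := Cs.cellularity_eq_aleph0 hX hXγ hXc
    -- A countable space is Lindelöf, so countable compactness upgrades to compactness.
    refine ⟨iff_of_true h ⟨IsLindelof.isCompact hX hXc.isLindelof, hXc⟩,
      iff_of_false ?_ (not_not_intro hXc)⟩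
    rw [h]
    exact Cardinal.aleph0_lt_aleph_one.ne
  · have h := Cs.cellularity_eq_aleph_one hX hXγ hXc
    refine ⟨iff_of_false ?_ fun h' => hXc h'.2, iff_of_true h hXc⟩
    rw [h]
    exact Cardinal.aleph0_lt_aleph_one.ne'
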